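/- All graphs are finite and simple, and the length of a path is its number of edges. There are absolute constants $C$ and $N$ such that the following holds for every $n\ge N$. Let $G$ be a cubic (that is, 3-regular) graph on $n$ vertices, not necessarily connected. Then the edges of $G$ can be coloured red and blue so that: 1. every monochromatic component (a connected component of the spanning subgraph of $G$ formed by all red edges, or of the one formed by all blue edges) is a path of length at most $C\log n$; 2. for every integer $t\ge 1$, the number of red components that are paths of length $t$ and the number of blue components that are paths of length $t$ differ by at most $n^{2/3}$. -/

import Mathlib

/-- The two colours used on the edges. -/
inductive EdgeColour : Type
  | red
  | blue

namespace EdgeColour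

variable {V : Type*} {G : SimpleGraph V}

/-- A monochromatic component of colour `c` is a connected component of the spanning subgraph
formed by all the edges of colour `c`. -/
abbrev MonoComponent (χ : G.EdgeLabeling EdgeColour) (c : EdgeColour) : Type _ :=
  (χ.labelGraph c).ConnectedComponent

/-- The monochromatic component `K` is a path of length `t`, that is, a path with `t` edges
(and `t + 1` vertices). -/
def IsPathOfLength {χ : G.EdgeLabeling EdgeColour} {c : EdgeColour}
    (K : MonoComponent χ c) (t : ℕ) : Prop :=
  Nonempty (K.toSimpleGraph ≃g SimpleGraph.pathGraph (t + 1))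

/-- The number of monochromatic components of colour `c` that are paths of length `t`. -/
noncomputable def numPaths (χ : G.EdgeLabeling EdgeColour) (c : EdgeColour) (t : ℕ) : ℕ :=
  {K : MonoComponent χ c | IsPathOfLength K t}.ncard

end EdgeColour

/-!
A depth-first search forest of `G` is normal: every edge joins a vertex to one of its ancestors. In
a cubic graph the edges can then be labelled by signed vertices, each label close to its edge, so
that at a nonroot the two edges not leading to the parent get opposite labels, and at a root one
marked edge gets the label opposite to that of the other two. A choice of one bit per vertex turns
signed labels into colours, opposite labels into different colours. For every choice of bits a
monochromatic path through a nonroot therefore passes through its parent. So every monochromatic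
component is a path (cycles through a root are excluded by the choice of the marked edge), and each
of the at most two parts into which a root divides it goes up and then down.

For random bits, a long monochromatic climb forces many bits, so all climbs, and hence all
components, are `O(log n)` long with high probability. Exchanging the colours complements the bits,
so the difference between the numbers of red and blue paths of a given length has mean zero.
Changing one bit changes it by `O(1)`. By the Efron–Stein inequality its variance is `O(n)`, and
Chebyshev's inequality leaves room for a union bound over the `O(log n)` relevant lengths.
-/

/-! ### Functions on the discrete cube -/

section Cube

variable {V : Type*} [DecidableEq V]

/-- The point of the cube obtained from `b` by changing its coordinate at `u`. -/
def flipBit (u : V) (b : V → Bool) : V → Bool :=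
  Function.update b u (!b u)

lemma flipBit_involutive (u : V) : Function.Involutive (flipBit u) := by
  intro b
  simp [flipBit]

lemma flipBit_comm (u w : V) (b : V → Bool) :
    flipBit u (flipBit w b) = flipBit w (flipBit u b) := by
  rcases eq_or_ne u w with rfl | h
  · rfl
  · simp [flipBit, h, h.symm, Function.update_comm h]

lemma flipBit_of_ne {u w : V} (h : w ≠ u) (b : V → Bool) : flipBit u b w = b w :=
  Function.update_of_ne h _ _

lemma update_eq_self_or_flipBit (u : V) (b : V → Bool) (c : Bool) :
    Function.update b u c = b ∨ Function.update b u c = flipBit u b := by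
  rcases Bool.eq_or_eq_not c (b u) with rfl | rfl
  · exact .inl (Function.update_eq_self u b)
  · exact .inr rfl

lemma eq_of_flipBit_invariant [Finite V] {α : Type*} {F : (V → Bool) → α}
    (hF : ∀ u b, F (flipBit u b) = F b) (b b' : V → Bool) : F b = F b' := by
  have := Fintype.ofFinite V
  have hpiecewise : ∀ S : Finset V, F (S.piecewise b b') = F b' := by
    intro S
    induction S using Finset.induction_on with
    | empty => rw [Finset.piecewise_empty]
    | insert u S _ ih =>
      rw [Finset.piecewise_insert, ← ih]
      rcases update_eq_self_or_flipBit u (S.piecewise b b') (b u) with h | h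
      · rw [h]
      · rw [h, hF]
  simpa using hpiecewise Finset.univ

/-- The average of `F` over the two values of the coordinate at `u`. -/
noncomputable def flipAverage (u : V) (F : (V → Bool) → ℝ) (b : V → Bool) : ℝ :=
  (F b + F (flipBit u b)) / 2

lemma flipAverage_flipBit_self (u : V) (F : (V → Bool) → ℝ) (b : V → Bool) :
    flipAverage u F (flipBit u b) = flipAverage u F b := by
  rw [flipAverage, flipAverage, flipBit_involutive, add_comm]

lemma flipAverage_flipBit (u w : V) (F : (V → Bool) → ℝ) (b : V → Bool) :
    flipAverage u F (flipBit w b) = (F (flipBit w b) + F (flipBit w (flipBit u b))) / 2 := by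
  rw [flipAverage, flipBit_comm]

variable [Fintype V]

lemma sum_flipBit (u : V) (F : (V → Bool) → ℝ) : ∑ b, F (flipBit u b) = ∑ b, F b :=
  Equiv.sum_comp (flipBit_involutive u).toPerm F

lemma sum_flipAverage (u : V) (F : (V → Bool) → ℝ) : ∑ b, flipAverage u F b = ∑ b, F b := by
  simp only [flipAverage]
  rw [← Finset.sum_div, Finset.sum_add_distrib, sum_flipBit, add_self_div_two]

/-- The energy of `F` in the direction `u`, normalized so that it is the second moment of the part
of `F` which is odd in the coordinate at `u`. -/
noncomputable def flipEnergy (u : V) (F : (V → Bool) → ℝ) : ℝ :=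
  ∑ b, ((F (flipBit u b) - F b) / 2) ^ 2

lemma sum_sq_eq_add_flipEnergy (u : V) (F : (V → Bool) → ℝ) :
    ∑ b, F b ^ 2 = ∑ b, flipAverage u F b ^ 2 + flipEnergy u F :=
  calc ∑ b, F b ^ 2
      = (∑ b, F b ^ 2 + ∑ b, F (flipBit u b) ^ 2) / 2 := by
        rw [sum_flipBit u fun b => F b ^ 2, add_self_div_two]
    _ = ∑ b, flipAverage u F b ^ 2 + flipEnergy u F := by
        rw [flipEnergy, ← Finset.sum_add_distrib, ← Finset.sum_add_distrib, Finset.sum_div]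
        refine Finset.sum_congr rfl fun b _ => ?_
        rw [flipAverage]
        ring

lemma flipEnergy_flipAverage_le (u w : V) (F : (V → Bool) → ℝ) :
    flipEnergy w (flipAverage u F) ≤ flipEnergy w F := by
  let g : (V → Bool) → ℝ := fun b => (F (flipBit w b) - F b) / 2
  calc flipEnergy w (flipAverage u F)
      = ∑ b, ((g b + g (flipBit u b)) / 2) ^ 2 := by
        refine Finset.sum_congr rfl fun b _ => ?_
        rw [flipAverage_flipBit, flipAverage]
        ring
    _ ≤ ∑ b, (g b ^ 2 + g (flipBit u b) ^ 2) / 2 :=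
        Finset.sum_le_sum fun b _ => by nlinarith [sq_nonneg (g b - g (flipBit u b))]
    _ = flipEnergy w F := by
        rw [← Finset.sum_div, Finset.sum_add_distrib, sum_flipBit u fun b => g b ^ 2,
          add_self_div_two, flipEnergy]

lemma sum_sq_le_sum_flipEnergy_of_invariant (S : Finset V) :
    ∀ F : (V → Bool) → ℝ, (∀ u ∉ S, ∀ b, F (flipBit u b) = F b) → ∑ b, F b = 0 →
      ∑ b, F b ^ 2 ≤ ∑ u ∈ S, flipEnergy u F := by
  induction S using Finset.induction_on with
  | empty =>
    intro F hF hsum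
    have hconst := eq_of_flipBit_invariant fun u => hF u (Finset.notMem_empty u)
    have hzero : ∀ b, F b = 0 := fun b => by
      rw [Finset.sum_congr rfl fun b' _ => hconst b' b] at hsum
      simpa using hsum
    simp [hzero]
  | insert u S hu ih =>
    intro F hF hsum
    have hinv : ∀ w ∉ S, ∀ b, flipAverage u F (flipBit w b) = flipAverage u F b := by
      intro w hw b
      rcases eq_or_ne w u with rfl | hwu
      · exact flipAverage_flipBit_self w F b
      · have hw' : w ∉ insert u S := by simp [hwu, hw]
        rw [flipAverage_flipBit, hF w hw', hF w hw', flipAverage]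
    calc ∑ b, F b ^ 2
        = ∑ b, flipAverage u F b ^ 2 + flipEnergy u F := sum_sq_eq_add_flipEnergy u F
      _ ≤ ∑ w ∈ S, flipEnergy w (flipAverage u F) + flipEnergy u F :=
          add_le_add_left (ih _ hinv ((sum_flipAverage u F).trans hsum)) _
      _ ≤ ∑ w ∈ S, flipEnergy w F + flipEnergy u F :=
          add_le_add_left (Finset.sum_le_sum fun w _ => flipEnergy_flipAverage_le u w F) _
      _ = ∑ w ∈ insert u S, flipEnergy w F := by rw [Finset.sum_insert hu, add_comm]

theorem sum_sq_le_sum_flipEnergy {F : (V → Bool) → ℝ} (hF : ∑ b, F b = 0) :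
    ∑ b, F b ^ 2 ≤ ∑ u, flipEnergy u F :=
  sum_sq_le_sum_flipEnergy_of_invariant Finset.univ F (by simp) hF

lemma flipEnergy_le {u : V} {F : (V → Bool) → ℝ} {D : ℝ}
    (hD : ∀ b, |F (flipBit u b) - F b| ≤ 2 * D) :
    flipEnergy u F ≤ 2 ^ Fintype.card V * D ^ 2 := by
  have hterm : ∀ b, ((F (flipBit u b) - F b) / 2) ^ 2 ≤ D ^ 2 := fun b => by
    have h := abs_le.1 (hD b)
    exact sq_le_sq' (by linarith) (by linarith)
  calc flipEnergy u F ≤ ∑ _b : V → Bool, D ^ 2 := Finset.sum_le_sum fun b _ => hterm b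
    _ = 2 ^ Fintype.card V * D ^ 2 := by simp

open Finset in
theorem card_lt_abs_mul_sq_le {F : (V → Bool) → ℝ} (hF : ∑ b, F b = 0) {D : ℝ}
    (hD : ∀ u b, |F (flipBit u b) - F b| ≤ 2 * D) {y : ℝ} (hy : 0 ≤ y) :
    #{b | y < |F b|} * y ^ 2 ≤ Fintype.card V * (2 ^ Fintype.card V * D ^ 2) :=
  calc (#{b | y < |F b|} : ℝ) * y ^ 2
      ≤ ∑ b with y < |F b|, F b ^ 2 := by
        rw [← nsmul_eq_mul]
        refine card_nsmul_le_sum _ _ _ fun b hb => ?_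
        rw [← sq_abs (F b)]
        exact pow_le_pow_left₀ hy (mem_filter.1 hb).2.le 2
    _ ≤ ∑ b, F b ^ 2 :=
        sum_le_sum_of_subset_of_nonneg (filter_subset _ _) fun b _ _ => sq_nonneg (F b)
    _ ≤ ∑ u, flipEnergy u F := sum_sq_le_sum_flipEnergy hF
    _ ≤ ∑ _u : V, 2 ^ Fintype.card V * D ^ 2 := sum_le_sum fun u _ => flipEnergy_le (hD u)
    _ = Fintype.card V * (2 ^ Fintype.card V * D ^ 2) := by simp

open Finset in
lemma card_filter_eqOn_mul_two_pow (S : Finset V) (a : V → Bool) :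
    #{b : V → Bool | ∀ u ∈ S, b u = a u} * 2 ^ #S = 2 ^ Fintype.card V := by
  have hpi : ({b : V → Bool | ∀ u ∈ S, b u = a u} : Finset _) =
      Fintype.piFinset fun u => if u ∈ S then {a u} else univ := by
    ext b
    simp only [mem_filter_univ, Fintype.mem_piFinset]
    refine forall_congr' fun u => ?_
    by_cases hu : u ∈ S <;> simp [hu]
  have hS : 2 ^ #S = ∏ u, if u ∈ S then 2 else 1 := by simp
  rw [hpi, Fintype.card_piFinset, hS, ← prod_mul_distrib, Fintype.card, ← prod_const]
  refine prod_congr rfl fun u _ => ?_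
  by_cases hu : u ∈ S <;> simp [hu]

end Cube

/-! ### Components that are paths -/

section PathCriterion

open SimpleGraph

variable {V : Type*} {H : SimpleGraph V}

lemma exists_adj_dist_eq_of_dist_eq_succ (hH : H.Connected) {u v : V} {k : ℕ}
    (hk : H.dist u v = k + 1) : ∃ w, H.Adj w v ∧ H.dist u w = k := by
  obtain ⟨p, hp⟩ := hH.exists_walk_length_eq_dist v u
  rw [dist_comm, hk] at hp
  cases p with
  | nil => simp at hp
  | @cons _ w _ h q =>
    refine ⟨w, h.symm, ?_⟩
    have hle := dist_le q
    rw [dist_comm] at hle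
    have hdiff := h.symm.diff_dist_adj (u := u)
    simp only [Walk.length_cons] at hp
    omega

lemma exists_dist_eq_of_le_dist (hH : H.Connected) {u v : V} {i : ℕ} (hi : i ≤ H.dist u v) :
    ∃ w, H.dist u w = i := by
  induction hi using Nat.decreasingInduction with
  | self => exact ⟨v, rfl⟩
  | of_succ k _ ih =>
    obtain ⟨w, hw⟩ := ih
    obtain ⟨x, -, hx⟩ := exists_adj_dist_eq_of_dist_eq_succ hH hw
    exact ⟨x, hx⟩

lemma eq_or_eq_or_eq_of_ncard_le_two {α : Type*} [Finite α] {s : Set α} (hs : s.ncard ≤ 2)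
    {a b c : α} (ha : a ∈ s) (hb : b ∈ s) (hc : c ∈ s) : a = b ∨ a = c ∨ b = c := by
  by_contra! h
  exact hs.not_gt ((Set.two_lt_ncard_iff).2 ⟨a, b, c, ha, hb, hc, h.1, h.2.1, h.2.2⟩)

variable [Finite V]

lemma dist_injective_of_ncard_neighborSet_le_two (hH : H.Connected)
    (hdeg : ∀ v, (H.neighborSet v).ncard ≤ 2) {u : V} (hu : (H.neighborSet u).Subsingleton) :
    Function.Injective (H.dist u) := by
  suffices ∀ k v w, H.dist u v = k → H.dist u w = k → v = w from
    fun v w h => this _ v w rfl h.symm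
  intro k
  induction k with
  | zero =>
    intro v w hv hw
    rw [hH.dist_eq_zero_iff] at hv hw
    exact hv.symm.trans hw
  | succ k ih =>
    intro v w hv hw
    obtain ⟨x, hxv, hx⟩ := exists_adj_dist_eq_of_dist_eq_succ hH hv
    obtain ⟨x', hxw, hx'⟩ := exists_adj_dist_eq_of_dist_eq_succ hH hw
    obtain rfl := ih x x' hx hx'
    rcases k with - | k
    · obtain rfl := hH.dist_eq_zero_iff.1 hx
      exact hu hxv hxw
    · obtain ⟨z, hzx, hz⟩ := exists_adj_dist_eq_of_dist_eq_succ hH hx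
      rcases eq_or_eq_or_eq_of_ncard_le_two (hdeg x) hzx.symm hxv hxw with rfl | rfl | h
      · omega
      · omega
      · exact h

theorem exists_iso_pathGraph_of_connected (hH : H.Connected)
    (hdeg : ∀ v, (H.neighborSet v).ncard ≤ 2) {u : V} (hu : (H.neighborSet u).Subsingleton) :
    ∃ t : ℕ, Nonempty (H ≃g pathGraph (t + 1)) := by
  have hinj := dist_injective_of_ncard_neighborSet_le_two hH hdeg hu
  have : Nonempty V := ⟨u⟩
  obtain ⟨m, hm⟩ := Finite.exists_max (H.dist u)
  have hbij : Function.Bijective fun v => (⟨H.dist u v, Nat.lt_succ_of_le (hm v)⟩ :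
      Fin (H.dist u m + 1)) := by
    refine ⟨fun v w h => hinj (Fin.mk.inj h), fun i => ?_⟩
    obtain ⟨v, hv⟩ := exists_dist_eq_of_le_dist hH (Nat.le_of_lt_succ i.2)
    exact ⟨v, Fin.ext hv⟩
  have hadj : ∀ {v w}, H.dist u v + 1 = H.dist u w → H.Adj v w := fun {v w} h => by
    obtain ⟨x, hxw, hx⟩ := exists_adj_dist_eq_of_dist_eq_succ hH h.symm
    exact hinj hx ▸ hxw
  refine ⟨H.dist u m, ⟨⟨Equiv.ofBijective _ hbij, fun {v w} => ?_⟩⟩⟩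
  rw [pathGraph_adj]
  refine ⟨fun h => h.elim hadj fun h => (hadj h).symm, fun h => ?_⟩
  have hne : H.dist u v ≠ H.dist u w := hinj.ne h.ne
  have hdiff := h.diff_dist_adj (u := u)
  simp only [Equiv.ofBijective_apply]
  omega

end PathCriterion

section ComponentCount

open SimpleGraph

variable {V W : Type*} {H H' : SimpleGraph V} {S : Set V}

/-- The number of connected components of `H` that are isomorphic to `Γ`. -/
noncomputable def numIsoComponents (H : SimpleGraph V) (Γ : SimpleGraph W) : ℕ :=
  {K : H.ConnectedComponent | Nonempty (K.toSimpleGraph ≃g Γ)}.ncard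

lemma reachable_of_agree (hS : ∀ x ∉ S, ∀ y, H.Adj x y ↔ H'.Adj x y) {v w : V}
    (hv : ∀ z, H.Reachable v z → z ∉ S) (h : H.Reachable v w) : H'.Reachable v w := by
  rw [reachable_iff_reflTransGen] at h
  induction h with
  | refl => rfl
  | tail hx hxy ih =>
    rw [← reachable_iff_reflTransGen] at hx
    exact ih.trans ((hS _ (hv _ hx) _).1 hxy).reachable

lemma reachable_iff_of_agree (hS : ∀ x ∉ S, ∀ y, H.Adj x y ↔ H'.Adj x y) {v w : V}
    (hv : ∀ z, H.Reachable v z → z ∉ S) : H'.Reachable v w ↔ H.Reachable v w := by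
  refine ⟨fun h => ?_, reachable_of_agree hS hv⟩
  rw [reachable_iff_reflTransGen] at h
  induction h with
  | refl => rfl
  | tail _ hxy ih => exact ih.trans ((hS _ (hv _ ih) _).2 hxy).reachable

lemma exists_component_of_agree (hS : ∀ x ∉ S, ∀ y, H.Adj x y ↔ H'.Adj x y)
    {K : H.ConnectedComponent} (hK : Disjoint K.supp S) :
    ∃ K' : H'.ConnectedComponent, K'.supp = K.supp ∧
      Nonempty (K'.toSimpleGraph ≃g K.toSimpleGraph) := by
  rw [Set.disjoint_left] at hK
  induction K using ConnectedComponent.ind with | _ v =>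
  have hv : ∀ z, H.Reachable v z → z ∉ S := fun z hz =>
    hK (ConnectedComponent.sound hz.symm)
  have hsupp : (H'.connectedComponentMk v).supp = (H.connectedComponentMk v).supp := by
    ext w
    simp only [ConnectedComponent.mem_supp_iff, ConnectedComponent.eq]
    rw [reachable_comm, reachable_iff_of_agree hS hv, reachable_comm]
  refine ⟨H'.connectedComponentMk v, hsupp, ⟨Equiv.setCongr hsupp, fun {a b} => ?_⟩⟩
  exact hS a (hK (hsupp ▸ a.2)) b

theorem numIsoComponents_le_add_of_agree [Finite V]
    (hS : ∀ x ∉ S, ∀ y, H.Adj x y ↔ H'.Adj x y) (Γ : SimpleGraph W) :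
    numIsoComponents H Γ ≤ numIsoComponents H' Γ + S.ncard := by
  let P := {K : H.ConnectedComponent | Nonempty (K.toSimpleGraph ≃g Γ)}
  let M := {K : H.ConnectedComponent | Disjoint K.supp S}
  have hmeet : (P \ M).ncard ≤ S.ncard := by
    have hsub : P \ M ⊆ H.connectedComponentMk '' S := by
      rintro K ⟨-, hK⟩
      obtain ⟨v, hvK, hvS⟩ := Set.not_disjoint_iff.1 hK
      exact ⟨v, hvS, hvK⟩
    exact (Set.ncard_le_ncard hsub).trans (Set.ncard_image_le S.toFinite)
  have havoid : (P ∩ M).ncard ≤ numIsoComponents H' Γ := by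
    rw [numIsoComponents,
      ← Set.ncard_image_of_injective (P ∩ M) ConnectedComponent.supp_injective,
      ← Set.ncard_image_of_injective _ ConnectedComponent.supp_injective]
    refine Set.ncard_le_ncard ?_
    rintro _ ⟨K, ⟨⟨hKΓ⟩, hKS⟩, rfl⟩
    obtain ⟨K', hsupp, ⟨e⟩⟩ := exists_component_of_agree hS hKS
    exact ⟨K', ⟨e.trans hKΓ⟩, hsupp⟩
  calc numIsoComponents H Γ = (P ∩ M).ncard + (P \ M).ncard :=
        (Set.ncard_inter_add_ncard_sdiff_eq_ncard P M).symm
    _ ≤ numIsoComponents H' Γ + S.ncard := add_le_add havoid hmeet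

end ComponentCount

/-! ### Normal spanning forests -/

/-- A rooted spanning forest of `G`. A root is its own parent. -/
structure RootedForest {V : Type*} (G : SimpleGraph V) where
  /-- The vertex below which a vertex hangs. -/
  parent : V → V
  /-- The number of steps from a vertex to its root. -/
  depth : V → ℕ
  depth_of_parent_eq : ∀ v, parent v = v → depth v = 0
  adj_parent : ∀ v, parent v ≠ v → G.Adj v (parent v)
  depth_parent_add_one : ∀ v, parent v ≠ v → depth (parent v) + 1 = depth v

namespace RootedForest

variable {V : Type*} {G : SimpleGraph V} (F : RootedForest G)

/-- `v` is the root of its tree. -/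
def IsRoot (v : V) : Prop := F.parent v = v

/-- `x` lies on the way from `y` to its root, the case `x = y` being allowed. -/
def IsAncestor (x y : V) : Prop := ∃ k, F.parent^[k] y = x

/-- The root of the tree that contains `v`. -/
def root (v : V) : V := F.parent^[F.depth v] v

instance : Inhabited (RootedForest G) :=
  ⟨{ parent := id
     depth := 0
     depth_of_parent_eq := fun _ _ => rfl
     adj_parent := fun _ h => absurd rfl h
     depth_parent_add_one := fun _ h => absurd rfl h }⟩

variable {F} {v x y z : V}

lemma isRoot_iff_depth_eq_zero : F.IsRoot v ↔ F.depth v = 0 := by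
  refine ⟨F.depth_of_parent_eq v, fun h => ?_⟩
  by_contra hv
  have := F.depth_parent_add_one v hv
  omega

lemma depth_parent (v : V) : F.depth (F.parent v) = F.depth v - 1 := by
  by_cases hv : F.IsRoot v
  · rw [hv, isRoot_iff_depth_eq_zero.1 hv]
  · exact Nat.eq_sub_of_add_eq (F.depth_parent_add_one v hv)

lemma depth_iterate (v : V) (k : ℕ) : F.depth (F.parent^[k] v) = F.depth v - k := by
  induction k with
  | zero => rfl
  | succ k ih => rw [Function.iterate_succ_apply', depth_parent, ih, Nat.sub_sub]

lemma depth_lt_card [Fintype V] (v : V) : F.depth v < Fintype.card V := by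
  classical
  have hsub : Finset.range (F.depth v + 1) ⊆ Finset.univ.image F.depth := fun i hi => by
    refine Finset.mem_image.2 ⟨F.parent^[F.depth v - i] v, Finset.mem_univ _, ?_⟩
    rw [depth_iterate, Nat.sub_sub_self (Finset.mem_range_succ_iff.1 hi)]
  simpa using (Finset.card_le_card hsub).trans Finset.card_image_le

lemma isRoot_root (v : V) : F.IsRoot (F.root v) := by
  rw [isRoot_iff_depth_eq_zero, root, depth_iterate, Nat.sub_self]

lemma IsRoot.root_eq (hv : F.IsRoot v) : F.root v = v :=
  Function.iterate_fixed hv _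

lemma root_parent (v : V) : F.root (F.parent v) = F.root v := by
  by_cases hv : F.IsRoot v
  · rw [hv]
  · rw [root, root, ← F.depth_parent_add_one v hv, Function.iterate_succ_apply]

namespace IsAncestor

lemma refl (x : V) : F.IsAncestor x x := ⟨0, rfl⟩

lemma of_parent (h : F.IsAncestor x (F.parent y)) : F.IsAncestor x y :=
  let ⟨k, hk⟩ := h
  ⟨k + 1, hk⟩

lemma parent_right (h : F.IsAncestor x y) (hxy : y ≠ x) : F.IsAncestor x (F.parent y) := by
  obtain ⟨k, hk⟩ := h
  cases k with
  | zero => exact absurd hk hxy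
  | succ k => exact ⟨k, hk⟩

lemma depth_le (h : F.IsAncestor x y) : F.depth x ≤ F.depth y := by
  obtain ⟨k, rfl⟩ := h
  rw [depth_iterate]
  exact Nat.sub_le _ _

lemma root_eq (h : F.IsAncestor x y) : F.root x = F.root y := by
  obtain ⟨k, rfl⟩ := h
  induction k with
  | zero => rfl
  | succ k ih => rw [Function.iterate_succ_apply', root_parent, ih]

lemma iterate_eq (h : F.IsAncestor x y) : F.parent^[F.depth y - F.depth x] y = x := by
  by_cases hx : F.IsRoot x
  · rw [isRoot_iff_depth_eq_zero.1 hx, Nat.sub_zero, ← root, ← h.root_eq, hx.root_eq]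
  · obtain ⟨k, rfl⟩ := h
    rw [isRoot_iff_depth_eq_zero, depth_iterate] at hx
    rw [depth_iterate, Nat.sub_sub_self (by omega)]

lemma eq_of_depth_eq (hx : F.IsAncestor x z) (hy : F.IsAncestor y z)
    (h : F.depth x = F.depth y) : x = y := by
  rw [← hx.iterate_eq, h, hy.iterate_eq]

lemma exists_child (h : F.IsAncestor x y) (hd : F.depth x < F.depth y) :
    ∃ q, G.Adj x q ∧ F.parent q = x ∧ F.depth q = F.depth x + 1 ∧ F.IsAncestor q y := by
  have hstep := h.iterate_eq
  obtain ⟨k, hk⟩ : ∃ k, F.depth y - F.depth x = k + 1 := ⟨_, (Nat.succ_pred (by omega)).symm⟩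
  rw [hk, Function.iterate_succ_apply'] at hstep
  have hdepth : F.depth (F.parent^[k] y) = F.depth x + 1 := by
    rw [depth_iterate]
    omega
  have hadj := F.adj_parent (F.parent^[k] y) fun h => by
    rw [F.depth_of_parent_eq _ h] at hdepth
    omega
  rw [hstep] at hadj
  exact ⟨F.parent^[k] y, hadj.symm, hstep, hdepth, k, rfl⟩

end IsAncestor

open Classical in
/-- The forest in which the subtree of `x` is moved below the neighbour `y` of `x`. -/
noncomputable def rehang (F : RootedForest G) {x y : V} (hxy : G.Adj x y)
    (hy : ¬ F.IsAncestor x y) : RootedForest G where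
  parent := Function.update F.parent x y
  depth v := if F.IsAncestor x v then F.depth v - F.depth x + (F.depth y + 1) else F.depth v
  depth_of_parent_eq v hv := by
    rcases eq_or_ne v x with rfl | hvx
    · exact absurd hv (by simpa using hxy.ne')
    · rw [Function.update_of_ne hvx] at hv
      rw [if_neg, F.depth_of_parent_eq v hv]
      rintro ⟨k, hk⟩
      rw [Function.iterate_fixed hv] at hk
      exact hvx hk
  adj_parent v hv := by
    rcases eq_or_ne v x with rfl | hvx
    · simpa using hxy
    · rw [Function.update_of_ne hvx] at hv ⊢
      exact F.adj_parent v hv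
  depth_parent_add_one v hv := by
    rcases eq_or_ne v x with rfl | hvx
    · simp [hy, IsAncestor.refl]
    · rw [Function.update_of_ne hvx] at hv ⊢
      have hd := F.depth_parent_add_one v hv
      by_cases hxv : F.IsAncestor x v
      · have hxp := hxv.parent_right hvx
        have hle := hxp.depth_le
        rw [if_pos hxp, if_pos hxv]
        omega
      · rw [if_neg fun h => hxv h.of_parent, if_neg hxv, hd]

lemma sum_depth_lt_sum_depth_rehang [Fintype V] (hxy : G.Adj x y) (hy : ¬ F.IsAncestor x y)
    (hd : F.depth x ≤ F.depth y) : ∑ v, F.depth v < ∑ v, (F.rehang hxy hy).depth v := by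
  refine Finset.sum_lt_sum (fun v _ => ?_) ⟨x, Finset.mem_univ x, ?_⟩
  · simp only [rehang]
    split_ifs <;> omega
  · simp only [rehang, if_pos (IsAncestor.refl x)]
    omega

variable (F) in
/-- A normal spanning forest, as produced by depth-first search: every edge of `G` joins a vertex
to one of its ancestors. -/
def IsNormal : Prop := ∀ ⦃x y⦄, G.Adj x y → F.depth x ≤ F.depth y → F.IsAncestor x y

theorem exists_isNormal [Finite V] (G : SimpleGraph V) : ∃ F : RootedForest G, F.IsNormal := by
  have := Fintype.ofFinite V
  have hbdd : BddAbove (Set.range fun F : RootedForest G => ∑ v, F.depth v) := by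
    refine ⟨∑ _v : V, Fintype.card V, ?_⟩
    rintro _ ⟨F, rfl⟩
    exact Finset.sum_le_sum fun v _ => (depth_lt_card v).le
  obtain ⟨F, hF⟩ := Nat.sSup_mem (Set.range_nonempty _) hbdd
  refine ⟨F, fun x y hxy hd => ?_⟩
  by_contra hy
  have hle := le_csSup hbdd ⟨F.rehang hxy hy, rfl⟩
  rw [← hF] at hle
  exact hle.not_gt (sum_depth_lt_sum_depth_rehang hxy hy hd)

namespace IsNormal

lemma depth_ne (hF : F.IsNormal) (hxy : G.Adj x y) : F.depth x ≠ F.depth y := fun hd =>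
  hxy.ne ((hF hxy hd.le).eq_of_depth_eq (.refl y) hd)

lemma root_eq_of_adj (hF : F.IsNormal) (hxy : G.Adj x y) : F.root x = F.root y := by
  rcases le_total (F.depth x) (F.depth y) with hd | hd
  · exact (hF hxy hd).root_eq
  · exact (hF hxy.symm hd).root_eq.symm

lemma depth_lt_of_isRoot (hF : F.IsNormal) (hx : F.IsRoot x) (hxy : G.Adj x y) :
    F.depth x < F.depth y := by
  have := hF.depth_ne hxy
  rw [isRoot_iff_depth_eq_zero.1 hx] at this ⊢
  exact Nat.pos_of_ne_zero this.symm

end IsNormal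

end RootedForest

/-! ### Signed labels of the edges of a cubic graph -/

section SmallSets

variable {α : Type*} {s : Set α}

lemma exists_mem_ne_ne_of_two_lt_ncard (hs : 2 < s.ncard) (a b : α) :
    ∃ w ∈ s, w ≠ a ∧ w ≠ b := by
  have hpair : ({a, b} : Set α).ncard ≤ 2 := by simpa using Set.ncard_insert_le a {b}
  obtain ⟨w, hw, hab⟩ := Set.exists_mem_notMem_of_ncard_lt_ncard (hpair.trans_lt hs)
  exact ⟨w, hw, by simpa using hab⟩

lemma eq_or_eq_or_eq_of_ncard_le_three [Finite α] (hs : s.ncard ≤ 3) {a b c e : α} (ha : a ∈ s)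
    (hb : b ∈ s) (hc : c ∈ s) (hab : a ≠ b) (hac : a ≠ c) (hbc : b ≠ c) (he : e ∈ s) :
    e = a ∨ e = b ∨ e = c := by
  have hcard : ({a, b, c} : Set α).ncard = 3 := Set.ncard_eq_three.2 ⟨a, b, c, hab, hac, hbc, rfl⟩
  have hsub : {a, b, c} ⊆ s := by
    simp [Set.insert_subset_iff, ha, hb, hc]
  simpa [← Set.eq_of_subset_of_ncard_le hsub (hs.trans hcard.ge)] using he

end SmallSets

namespace RootedForest

variable {V : Type*} {G : SimpleGraph V} {F : RootedForest G} {f : V → V} {r v x y z : V}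

lemma IsNormal.exists_branch [Finite V] (hF : F.IsNormal) (hr : F.IsRoot r)
    (hne : (G.neighborSet r).Nonempty) (hdeg : (G.neighborSet r).ncard ≤ 3) :
    ∃ q, G.Adj r q ∧ F.parent q = r ∧
      ∀ x, G.Adj r x → F.parent x ≠ r → F.IsAncestor q x := by
  have hchild : ∀ x, G.Adj r x → ∃ q, G.Adj r q ∧ F.parent q = r ∧
      F.depth q = F.depth r + 1 ∧ F.IsAncestor q x := fun x hx =>
    have hd := hF.depth_lt_of_isRoot hr hx
    (hF hx hd.le).exists_child hd
  by_cases hback : ∃ x₀, G.Adj r x₀ ∧ F.parent x₀ ≠ r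
  · obtain ⟨x₀, hx₀, hpx₀⟩ := hback
    obtain ⟨q₀, hq₀, hpq₀, hdq₀, hanc₀⟩ := hchild x₀ hx₀
    refine ⟨q₀, hq₀, hpq₀, fun x hx hpx => ?_⟩
    obtain ⟨q, hq, hpq, hdq, hanc⟩ := hchild x hx
    suffices q₀ = q from this ▸ hanc
    by_contra hqq
    rcases eq_or_eq_or_eq_of_ncard_le_three hdeg hx₀ hq₀ hq (fun h => hpx₀ (h ▸ hpq₀))
      (fun h => hpx₀ (h ▸ hpq)) hqq hx with rfl | rfl | rfl
    · exact hqq (hanc₀.eq_of_depth_eq hanc (hdq₀.trans hdq.symm))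
    · exact hpx hpq₀
    · exact hpx hpq
  · push Not at hback
    obtain ⟨q, hq⟩ := hne
    exact ⟨q, hq, hback q hq, fun x hx hpx => absurd (hback x hx) hpx⟩

/-- `f` marks at every vertex one of the edges that do not lead to the parent, and does not mark
an edge from a nonroot to its root. At a root it marks an edge to a child whose subtree contains
all the other neighbours that are not children of the root. -/
structure IsMarking (F : RootedForest G) (f : V → V) : Prop where
  adj : ∀ v, G.Adj v (f v)
  ne_parent : ∀ v, ¬ F.IsRoot v → f v ≠ F.parent v
  ne_root : ∀ v, ¬ F.IsRoot v → f v ≠ F.root v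
  parent_eq : ∀ r, F.IsRoot r → F.parent (f r) = r
  isAncestor : ∀ r, F.IsRoot r → ∀ x, G.Adj r x → F.parent x ≠ r → F.IsAncestor (f r) x

theorem IsNormal.exists_isMarking [Finite V] (hF : F.IsNormal)
    (hG : ∀ v, (G.neighborSet v).ncard = 3) : ∃ f, F.IsMarking f := by
  have hroot : ∀ r, F.IsRoot r → ∃ q, G.Adj r q ∧ F.parent q = r ∧
      ∀ x, G.Adj r x → F.parent x ≠ r → F.IsAncestor q x := fun r hr =>
    hF.exists_branch hr (Set.nonempty_of_ncard_ne_zero (by simp [hG])) (hG r).le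
  have hnonroot : ∀ v, ∃ w, G.Adj v w ∧ w ≠ F.parent v ∧ w ≠ F.root v := fun v =>
    exists_mem_ne_ne_of_two_lt_ncard (s := G.neighborSet v) (by simp [hG]) _ _
  choose! g hg using hroot
  choose k hk using hnonroot
  classical
  refine ⟨fun v => if F.IsRoot v then g v else k v, fun v => ?_, fun v hv => ?_, fun v hv => ?_,
    fun r hr => ?_, fun r hr => ?_⟩
  · split_ifs with hv
    exacts [(hg v hv).1, (hk v).1]
  · rw [if_neg hv]
    exact (hk v).2.1
  · rw [if_neg hv]
    exact (hk v).2.2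
  · rw [if_pos hr]
    exact (hg r hr).2.1
  · rw [if_pos hr]
    exact (hg r hr).2.2

end RootedForest

section AdaptedLabeling

variable {V : Type*} {G : SimpleGraph V}

/-- A signed label `(s, u)` stands for the bit of the vertex `u`, complemented if `s` is `true`.
The opposite label has the other sign. -/
def oppositeLabel (l : Bool × V) : Bool × V := (!l.1, l.2)

lemma oppositeLabel_involutive : Function.Involutive (oppositeLabel (V := V)) := fun l => by
  simp [oppositeLabel]

namespace RootedForest

/-- An edge labelling by signed labels is adapted to a forest and a marking of edges if opposite
labels are carried by the two edges from a nonroot that do not lead to its parent, and by the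
marked edge and any other edge at a root. -/
structure IsAdapted (F : RootedForest G) (f : V → V) (E : G.EdgeLabeling (Bool × V)) :
    Prop where
  nonroot : ∀ {v a c} (ha : G.Adj v a) (hc : G.Adj v c), ¬ F.IsRoot v → a ≠ c →
    a ≠ F.parent v → c ≠ F.parent v → E.get v a ha = oppositeLabel (E.get v c hc)
  root : ∀ {r a} (ha : G.Adj r a) (hf : G.Adj r (f r)), F.IsRoot r → a ≠ f r →
    E.get r a ha = oppositeLabel (E.get r (f r) hf)

section Labeling

variable (F : RootedForest G) (f : V → V)

open Classical in
/-- The vertex whose bit decides about the edges which take their label from `x`. Deferring to the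
root when `x` has a back edge to it makes this edge and the marked edge at the root comparable. -/
noncomputable def bitOwner (x : V) : V :=
  if G.Adj x (F.root x) ∧ F.parent x ≠ F.root x then F.root x else x

open Classical in
/-- The label that `x` proposes for its edge to `y`. -/
noncomputable def ownLabel (x y : V) : Bool × V := (decide (y = f x), F.bitOwner x)

/-- `zy` is a back edge from `z` up to `y`. -/
def IsBackEdge (z y : V) : Prop := G.Adj y z ∧ F.depth y < F.depth z ∧ F.parent z ≠ y

open Classical in
/-- The label of an edge from `x` up to `y`. A back edge is labelled by its lower end. A tree edge
is labelled by its upper end, unless a back edge from below enters that end: then it takes the label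
opposite to the one of the back edge. -/
noncomputable def upLabel (x y : V) : Bool × V :=
  if F.parent x ≠ y then F.ownLabel f x y
  else if h : ¬ F.IsRoot y ∧ ∃ z, F.IsBackEdge z y then oppositeLabel (F.ownLabel f h.2.choose y)
  else F.ownLabel f y x

end Labeling

variable {F : RootedForest G} {f : V → V} {r v x y z : V}

lemma upLabel_of_parent_ne (h : F.parent x ≠ y) : F.upLabel f x y = F.ownLabel f x y :=
  if_pos h

lemma exists_isBackEdge_upLabel_eq (hy : ¬ F.IsRoot y) (h : ∃ z, F.IsBackEdge z y) :
    ∃ z, F.IsBackEdge z y ∧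
      ∀ x, F.parent x = y → F.upLabel f x y = oppositeLabel (F.ownLabel f z y) :=
  ⟨h.choose, h.choose_spec, fun x hx => by rw [upLabel, if_neg (not_not.2 hx), dif_pos ⟨hy, h⟩]⟩

lemma upLabel_of_forall_not_isBackEdge (hx : F.parent x = y)
    (h : F.IsRoot y ∨ ∀ z, ¬ F.IsBackEdge z y) : F.upLabel f x y = F.ownLabel f y x := by
  rw [upLabel, if_neg (not_not.2 hx), dif_neg]
  rintro ⟨hy, z, hz⟩
  exact h.elim hy fun h => h z hz

lemma edist_bitOwner_le (x : V) : G.edist x (F.bitOwner x) ≤ 1 := by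
  rw [SimpleGraph.edist_le_one_iff_adj_or_eq, bitOwner]
  split_ifs with h
  exacts [.inl h.1, .inr rfl]

lemma edist_bitOwner_le_of_adj (h : G.Adj y x) : G.edist y (F.bitOwner x) ≤ 2 :=
  calc G.edist y (F.bitOwner x)
      ≤ G.edist y x + G.edist x (F.bitOwner x) := SimpleGraph.edist_triangle
    _ ≤ 1 + 1 := add_le_add (SimpleGraph.edist_le_one_iff_adj_or_eq.2 (.inl h))
        (edist_bitOwner_le x)
    _ = 2 := one_add_one_eq_two

lemma edist_upLabel_le (hxy : G.Adj y x) : G.edist y (F.upLabel f x y).2 ≤ 2 := by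
  rw [upLabel]
  split_ifs with _ h
  · exact edist_bitOwner_le_of_adj hxy
  · exact edist_bitOwner_le_of_adj h.2.choose_spec.1
  · exact (edist_bitOwner_le y).trans one_le_two

/-- The edge labelling given by `RootedForest.upLabel`. -/
noncomputable def IsNormal.labeling (hF : F.IsNormal) (f : V → V) :
    G.EdgeLabeling (Bool × V) :=
  .mk (fun x y _ => if F.depth y < F.depth x then F.upLabel f x y else F.upLabel f y x)
    fun x y h => by
      rcases (hF.depth_ne h).lt_or_gt with hd | hd <;> simp only [hd, hd.not_gt, if_true, if_false]

namespace IsNormal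

lemma get_labeling (hF : F.IsNormal) (h : G.Adj x y) (hd : F.depth y < F.depth x) :
    (hF.labeling f).get x y h = F.upLabel f x y :=
  if_pos hd

lemma get_labeling' (hF : F.IsNormal) (h : G.Adj y x) (hd : F.depth y < F.depth x) :
    (hF.labeling f).get y x h = F.upLabel f x y :=
  if_neg hd.not_gt

lemma edist_get_labeling_le (hF : F.IsNormal) (h : G.Adj x y) :
    G.edist x ((hF.labeling f).get x y h).2 ≤ 3 := by
  rcases (hF.depth_ne h).lt_or_gt with hd | hd
  · rw [hF.get_labeling' h hd]
    exact (edist_upLabel_le h).trans (by norm_num)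
  · rw [hF.get_labeling h hd]
    calc G.edist x (F.upLabel f x y).2
        ≤ G.edist x y + G.edist y (F.upLabel f x y).2 := SimpleGraph.edist_triangle
      _ ≤ 1 + 2 := add_le_add (SimpleGraph.edist_le_one_iff_adj_or_eq.2 (.inl h))
          (edist_upLabel_le h.symm)
      _ = 3 := by norm_num

lemma get_labeling_of_forall_not_isBackEdge (hF : F.IsNormal) (hv : ∀ z, ¬ F.IsBackEdge z v)
    (h : G.Adj v x) (hx : x ≠ F.parent v) : (hF.labeling f).get v x h = F.ownLabel f v x := by
  rcases (hF.depth_ne h).lt_or_gt with hd | hd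
  · have hpx : F.parent x = v := by_contra fun hpx => hv x ⟨h, hd, hpx⟩
    rw [hF.get_labeling' h hd, upLabel_of_forall_not_isBackEdge hpx (.inr hv)]
  · rw [hF.get_labeling h hd, upLabel_of_parent_ne hx.symm]

lemma exists_get_labeling_eq_opposite [Finite V] (hF : F.IsNormal) (hf : F.IsMarking f)
    (hdeg : 2 < (G.neighborSet v).ncard) (hv : ¬ F.IsRoot v) :
    ∃ x y, ∃ (hx : G.Adj v x) (hy : G.Adj v y), x ≠ y ∧ x ≠ F.parent v ∧ y ≠ F.parent v ∧
      (hF.labeling f).get v x hx = oppositeLabel ((hF.labeling f).get v y hy) := by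
  by_cases hback : ∃ z, F.IsBackEdge z v
  · obtain ⟨z, ⟨hvz, hd, hpz⟩, hz⟩ := exists_isBackEdge_upLabel_eq (f := f) hv hback
    obtain ⟨q, hvq, hpq, hdq, -⟩ := (hF hvz hd.le).exists_child hd
    have hdv := F.depth_parent_add_one v hv
    refine ⟨q, z, hvq, hvz, fun h => hpz (h ▸ hpq), fun h => ?_, fun h => ?_, ?_⟩
    · rw [h] at hdq
      omega
    · rw [h] at hd
      omega
    · rw [hF.get_labeling' hvq (by omega), hF.get_labeling' hvz hd, hz q hpq,
        upLabel_of_parent_ne hpz]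
  · push Not at hback
    obtain ⟨g, hg, hgp, hgf⟩ := exists_mem_ne_ne_of_two_lt_ncard hdeg (F.parent v) (f v)
    refine ⟨g, f v, hg, hf.adj v, hgf, hgp, hf.ne_parent v hv, ?_⟩
    rw [hF.get_labeling_of_forall_not_isBackEdge hback hg hgp,
      hF.get_labeling_of_forall_not_isBackEdge hback (hf.adj v) (hf.ne_parent v hv)]
    simp [ownLabel, oppositeLabel, hgf]

open Classical in
lemma get_labeling_of_isRoot (hF : F.IsNormal) (hf : F.IsMarking f) (hr : F.IsRoot r)
    (h : G.Adj r x) : (hF.labeling f).get r x h = (decide (x = f r), r) := by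
  have hd := hF.depth_lt_of_isRoot hr h
  rw [hF.get_labeling' h hd]
  by_cases hpx : F.parent x = r
  · rw [upLabel_of_forall_not_isBackEdge hpx (.inl hr), ownLabel, bitOwner, if_neg]
    rw [hr.root_eq]
    exact fun h => h.2 hr
  · have hrx : F.root x = r := (hF.root_eq_of_adj h).symm.trans hr.root_eq
    have hx : ¬ F.IsRoot x := fun hx => by
      rw [isRoot_iff_depth_eq_zero.1 hx] at hd
      exact hd.not_ge (Nat.zero_le _)
    have hxr : r ≠ f x := hrx ▸ (hf.ne_root x hx).symm
    have hxf : x ≠ f r := fun h => hpx (h ▸ hf.parent_eq r hr)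
    simp [upLabel_of_parent_ne hpx, ownLabel, bitOwner, hrx, h.symm, hpx, hxr, hxf]

theorem isAdapted_labeling [Finite V] (hF : F.IsNormal) (hf : F.IsMarking f)
    (hG : ∀ v, (G.neighborSet v).ncard = 3) : F.IsAdapted f (hF.labeling f) where
  nonroot {v a c} ha hc hv hac hap hcp := by
    have hcover : ∀ e, G.Adj v e → e ≠ F.parent v → e = a ∨ e = c := fun e he hep =>
      (eq_or_eq_or_eq_of_ncard_le_three (hG v).le (F.adj_parent v hv) ha hc hap.symm hcp.symm hac
        he).resolve_left hep
    obtain ⟨x, y, hx, hy, hxy, hxp, hyp, heq⟩ :=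
      hF.exists_get_labeling_eq_opposite hf (by simp [hG]) hv
    rcases hcover x hx hxp with rfl | rfl <;> rcases hcover y hy hyp with rfl | rfl
    · exact absurd rfl hxy
    · exact heq
    · rw [heq, oppositeLabel_involutive]
    · exact absurd rfl hxy
  root {r a} ha hfr hr har := by
    rw [hF.get_labeling_of_isRoot hf hr ha, hF.get_labeling_of_isRoot hf hr hfr]
    simp [oppositeLabel, har]

end IsNormal

end RootedForest

end AdaptedLabeling

/-! ### Colouring by random bits -/

section Ball

open SimpleGraph

variable {V : Type*} {G : SimpleGraph V}

lemma eq_or_exists_adj_edist_le {u x : V} {k : ℕ} (h : G.edist u x ≤ k + 1) :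
    u = x ∨ ∃ w, G.Adj u w ∧ G.edist w x ≤ k := by
  obtain ⟨p, hp⟩ := exists_walk_of_edist_ne_top (ne_top_of_le_ne_top (by simp) h)
  cases p with
  | nil => exact .inl rfl
  | @cons _ w _ huw q =>
    refine .inr ⟨w, huw, (edist_le q).trans ?_⟩
    rw [← hp, Walk.length_cons] at h
    exact_mod_cast Nat.le_of_succ_le_succ (by exact_mod_cast h)

lemma ncard_edist_le_le_pow [Finite V] {Δ : ℕ} (hG : ∀ v, (G.neighborSet v).ncard ≤ Δ) (k : ℕ)
    (u : V) : {x | G.edist u x ≤ k}.ncard ≤ (Δ + 1) ^ k := by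
  classical
  have := Fintype.ofFinite V
  induction k generalizing u with
  | zero => simp
  | succ k ih =>
    let s := insert u (G.neighborFinset u)
    have hcard : s.card ≤ Δ + 1 := (Finset.card_insert_le _ _).trans <| by
      simpa [neighborFinset, Set.ncard_eq_toFinset_card'] using hG u
    have hsub : {x | G.edist u x ≤ (k + 1 : ℕ)} ⊆
        s.biUnion fun w => {x | G.edist w x ≤ k}.toFinset := fun x hx => by
      rcases eq_or_exists_adj_edist_le (by simpa using hx) with rfl | ⟨w, huw, hw⟩
      · simp [s]
      · simp only [Finset.coe_biUnion, Set.mem_iUnion, Set.coe_toFinset]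
        exact ⟨w, by simp [s, huw], hw⟩
    calc {x | G.edist u x ≤ (k + 1 : ℕ)}.ncard
        ≤ (s.biUnion fun w => {x | G.edist w x ≤ k}.toFinset).card := by
          rw [← Set.ncard_coe_finset]
          exact Set.ncard_le_ncard hsub
      _ ≤ s.card * (Δ + 1) ^ k := Finset.card_biUnion_le_card_mul _ _ _ fun w _ => by
          simpa [Set.ncard_eq_toFinset_card'] using ih w
      _ ≤ (Δ + 1) ^ (k + 1) := by
          rw [pow_succ']
          exact Nat.mul_le_mul_right _ hcard

end Ball

section RandomColouring

open EdgeColour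

variable {V : Type*} {G : SimpleGraph V}

open Classical in
/-- The colour that a signed label receives from the bits `b`. -/
noncomputable def labelColour (b : V → Bool) (l : Bool × V) : EdgeColour :=
  if l.1 = b l.2 then blue else red

lemma labelColour_oppositeLabel_ne (b : V → Bool) (l : Bool × V) :
    labelColour b (oppositeLabel l) ≠ labelColour b l := by
  cases h : l.1 <;> cases h' : b l.2 <;> simp [labelColour, oppositeLabel, h, h']

lemma labelColour_compl (b : V → Bool) (l : Bool × V) :
    labelColour bᶜ l = labelColour b (oppositeLabel l) := by
  cases h : l.1 <;> cases h' : b l.2 <;> simp [labelColour, oppositeLabel, h, h']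

lemma bit_eq_of_labelColour_eq {b b' : V → Bool} {l : Bool × V}
    (h : labelColour b l = labelColour b' l) : b l.2 = b' l.2 := by
  cases hl : l.1 <;> cases hb : b l.2 <;> cases hb' : b' l.2 <;>
    simp [labelColour, hl, hb, hb'] at h ⊢

/-- The edge colouring in which the bits `b` decide the colour of each signed label. -/
noncomputable def colouring (E : G.EdgeLabeling (Bool × V)) (b : V → Bool) :
    G.EdgeLabeling EdgeColour :=
  E.compRight (labelColour b)

/-- The vertices incident to an edge whose colour is decided by the bit of `u`. -/
def ownedVertices (E : G.EdgeLabeling (Bool × V)) (u : V) : Set V :=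
  {x | ∃ y, ∃ h : G.Adj x y, (E.get x y h).2 = u}

variable {E : G.EdgeLabeling (Bool × V)} {b : V → Bool} {c : EdgeColour}

lemma colouring_labelGraph_adj {x y : V} : ((colouring E b).labelGraph c).Adj x y ↔
    ∃ h : G.Adj x y, labelColour b (E.get x y h) = c :=
  SimpleGraph.EdgeLabeling.labelGraph_adj x y

lemma ncard_ownedVertices_le [Finite V] {Δ k : ℕ} (hG : ∀ v, (G.neighborSet v).ncard ≤ Δ)
    (hE : ∀ x y (h : G.Adj x y), G.edist x (E.get x y h).2 ≤ k) (u : V) :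
    (ownedVertices E u).ncard ≤ (Δ + 1) ^ k := by
  refine (Set.ncard_le_ncard ?_).trans (ncard_edist_le_le_pow hG k u)
  rintro x ⟨y, h, rfl⟩
  rw [Set.mem_ofPred_eq, SimpleGraph.edist_comm]
  exact hE x y h

lemma labelGraph_colouring_compl_eq {c' : EdgeColour} (hc : c ≠ c') :
    (colouring E bᶜ).labelGraph c = (colouring E b).labelGraph c' := by
  ext x y
  rw [colouring_labelGraph_adj, colouring_labelGraph_adj]
  refine exists_congr fun h => ?_
  have hne := labelColour_oppositeLabel_ne b (E.get x y h)
  rw [labelColour_compl]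
  revert hc hne
  cases labelColour b (oppositeLabel (E.get x y h)) <;> cases labelColour b (E.get x y h) <;>
    cases c <;> cases c' <;> simp

variable (E) in
/-- The surplus of red components that are paths of length `t`, as a function of the bits. -/
noncomputable def pathDiff (t : ℕ) (b : V → Bool) : ℝ :=
  numPaths (colouring E b) red t - numPaths (colouring E b) blue t

lemma numPaths_eq_numIsoComponents (χ : G.EdgeLabeling EdgeColour) (t : ℕ) :
    numPaths χ c t = numIsoComponents (χ.labelGraph c) (SimpleGraph.pathGraph (t + 1)) :=
  rfl

lemma pathDiff_compl (t : ℕ) (b : V → Bool) : pathDiff E t bᶜ = -pathDiff E t b := by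
  simp only [pathDiff, numPaths_eq_numIsoComponents]
  rw [labelGraph_colouring_compl_eq (c := red) (c' := blue) nofun,
    labelGraph_colouring_compl_eq (c := blue) (c' := red) nofun, neg_sub]

lemma numPaths_colouring_le_add [Finite V] [DecidableEq V] (t : ℕ) (u : V) (b : V → Bool) :
    numPaths (colouring E b) c t ≤
      numPaths (colouring E (flipBit u b)) c t + (ownedVertices E u).ncard := by
  refine numIsoComponents_le_add_of_agree (fun x hx y => ?_) _
  rw [colouring_labelGraph_adj, colouring_labelGraph_adj]
  refine exists_congr fun h => ?_
  have hne : (E.get x y h).2 ≠ u := fun hu => hx ⟨y, h, hu⟩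
  rw [labelColour, labelColour, flipBit_of_ne hne]

lemma abs_pathDiff_flipBit_sub_le [Finite V] [DecidableEq V] {M : ℕ}
    (hM : ∀ u, (ownedVertices E u).ncard ≤ M) (t : ℕ) (u : V) (b : V → Bool) :
    |pathDiff E t (flipBit u b) - pathDiff E t b| ≤ 2 * M := by
  have hle : ∀ b c, (numPaths (colouring E b) c t : ℝ) ≤
      numPaths (colouring E (flipBit u b)) c t + M := fun b c => by
    exact_mod_cast (numPaths_colouring_le_add t u b).trans (Nat.add_le_add_left (hM u) _)
  have hge : ∀ c, (numPaths (colouring E (flipBit u b)) c t : ℝ) ≤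
      numPaths (colouring E b) c t + M := fun c => by
    simpa only [flipBit_involutive u b] using hle (flipBit u b) c
  rw [pathDiff, pathDiff, abs_le]
  constructor <;> linarith [hle b red, hle b blue, hge red, hge blue]

variable [Fintype V] {M : ℕ}

lemma sum_pathDiff [DecidableEq V] (t : ℕ) : ∑ b, pathDiff E t b = 0 := by
  have h := Equiv.sum_comp (compl_involutive (α := V → Bool)).toPerm (pathDiff E t)
  simp only [Function.Involutive.coe_toPerm, pathDiff_compl, Finset.sum_neg_distrib] at h
  linarith

open Finset in
lemma card_lt_abs_pathDiff_mul_le [DecidableEq V] (hM : ∀ u, (ownedVertices E u).ncard ≤ M)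
    (t : ℕ) {y : ℝ} (hy : 0 < y) (hyn : y ^ 3 = Fintype.card V) :
    #{b | y ^ 2 < |pathDiff E t b|} * y ≤ 2 ^ Fintype.card V * M ^ 2 := by
  have h := card_lt_abs_mul_sq_le (sum_pathDiff t) (abs_pathDiff_flipBit_sub_le hM t)
    (pow_nonneg hy.le 2)
  rw [← hyn] at h
  refine le_of_mul_le_mul_left ?_ (pow_pos hy 3)
  calc y ^ 3 * (#{b | y ^ 2 < |pathDiff E t b|} * y)
      = #{b | y ^ 2 < |pathDiff E t b|} * (y ^ 2) ^ 2 := by ring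
    _ ≤ _ := h

open Classical Finset in
lemma card_forall_labelGraph_adj_mul_le (hM : ∀ u, (ownedVertices E u).ncard ≤ M) (hM₀ : 0 < M)
    {s : Finset V} {m : ℕ} (hs : M * m ≤ #s) (g : V → V) (c : EdgeColour) :
    #{b | ∀ x ∈ s, ((colouring E b).labelGraph c).Adj x (g x)} * 2 ^ m ≤ 2 ^ Fintype.card V := by
  set B : Finset (V → Bool) := {b | ∀ x ∈ s, ((colouring E b).labelGraph c).Adj x (g x)}
  rcases B.eq_empty_or_nonempty with hB | ⟨b₀, hb₀⟩
  · simp [hB]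
  have hlabel : ∀ b ∈ B, ∀ x ∈ s, ∃ h, labelColour b (E.get x (g x) h) = c := fun b hb x hx =>
    colouring_labelGraph_adj.1 ((mem_filter.1 hb).2 x hx)
  let owner : V → V := fun x => if h : G.Adj x (g x) then (E.get x (g x) h).2 else x
  have howner : ∀ x (h : G.Adj x (g x)), owner x = (E.get x (g x) h).2 := fun x h => dif_pos h
  have himage : m ≤ #(s.image owner) := by
    refine Nat.le_of_mul_le_mul_left (hs.trans (card_le_mul_card_image s M fun u _ => ?_)) hM₀
    rw [← Set.ncard_coe_finset]
    refine (Set.ncard_le_ncard fun x hx => ?_).trans (hM u)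
    obtain ⟨hxs, rfl⟩ := mem_filter.1 hx
    obtain ⟨h, -⟩ := hlabel b₀ hb₀ x hxs
    exact ⟨g x, h, (howner x h).symm⟩
  have hsub : B ⊆ ({b | ∀ u ∈ s.image owner, b u = b₀ u} : Finset (V → Bool)) := fun b hb => by
    rw [mem_filter_univ, forall_mem_image]
    intro x hx
    obtain ⟨h, hc⟩ := hlabel b hb x hx
    obtain ⟨_, hc₀⟩ := hlabel b₀ hb₀ x hx
    rw [howner x h]
    exact bit_eq_of_labelColour_eq (hc.trans hc₀.symm)
  calc #B * 2 ^ m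
      ≤ #{b : V → Bool | ∀ u ∈ s.image owner, b u = b₀ u} * 2 ^ #(s.image owner) :=
        Nat.mul_le_mul (card_le_card hsub) (Nat.pow_le_pow_right two_pos himage)
    _ = 2 ^ Fintype.card V := card_filter_eqOn_mul_two_pow _ b₀

end RandomColouring

/-! ### The shape of the colour classes -/

namespace RootedForest

variable {V : Type*} {G H : SimpleGraph V} {F : RootedForest G} {f : V → V} {q x y : V}

/-- `H` is a subgraph of `G` such that every path of `H` through a nonroot passes through its
parent, and no path of `H` through a root uses its marked edge. Both colour classes of an adapted
labelling have this property. -/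
structure IsClimbing (F : RootedForest G) (f : V → V) (H : SimpleGraph V) : Prop where
  le : H ≤ G
  nonroot : ∀ {v a b}, ¬ F.IsRoot v → H.Adj v a → H.Adj v b → a ≠ b →
    a = F.parent v ∨ b = F.parent v
  root : ∀ {r a b}, F.IsRoot r → H.Adj r a → H.Adj r b → a ≠ b → a ≠ f r

lemma IsAdapted.isClimbing {E : G.EdgeLabeling (Bool × V)} (hE : F.IsAdapted f E)
    (b : V → Bool) (c : EdgeColour) : F.IsClimbing f ((colouring E b).labelGraph c) where
  le := SimpleGraph.EdgeLabeling.labelGraph_le _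
  nonroot hv hx hy hxy := by
    obtain ⟨hx, hxc⟩ := colouring_labelGraph_adj.1 hx
    obtain ⟨hy, hyc⟩ := colouring_labelGraph_adj.1 hy
    by_contra! h
    rw [hE.nonroot hx hy hv hxy h.1 h.2] at hxc
    exact labelColour_oppositeLabel_ne b _ (hxc.trans hyc.symm)
  root hr hx hy hxy := by
    rintro rfl
    obtain ⟨hx, hxc⟩ := colouring_labelGraph_adj.1 hx
    obtain ⟨hy, hyc⟩ := colouring_labelGraph_adj.1 hy
    rw [hE.root hy hx hr hxy.symm] at hyc
    exact labelColour_oppositeLabel_ne b _ (hyc.trans hxc.symm)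

namespace IsClimbing

lemma adj_parent (hH : F.IsClimbing f H) (hx : ¬ F.IsRoot x) (h : (H.neighborSet x).Nontrivial) :
    H.Adj x (F.parent x) := by
  obtain ⟨a, ha, b, hb, hab⟩ := h
  rcases hH.nonroot hx ha hb hab with rfl | rfl
  exacts [ha, hb]

lemma ncard_neighborSet_le_two [Finite V] (hH : F.IsClimbing f H) (hf : F.IsMarking f)
    (hG : ∀ v, (G.neighborSet v).ncard ≤ 3) (v : V) : (H.neighborSet v).ncard ≤ 2 := by
  by_contra! h
  obtain ⟨a, b, c, ha, hb, hc, hab, hac, hbc⟩ := (Set.two_lt_ncard_iff).1 h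
  by_cases hv : F.IsRoot v
  · rcases eq_or_eq_or_eq_of_ncard_le_three (hG v) (hH.le ha) (hH.le hb) (hH.le hc) hab hac hbc
      (hf.adj v) with h | h | h
    · exact hH.root hv ha hb hab h.symm
    · exact hH.root hv hb ha hab.symm h.symm
    · exact hH.root hv hc ha hac.symm h.symm
  · have hab' := hH.nonroot hv ha hb hab
    have hac' := hH.nonroot hv ha hc hac
    have hbc' := hH.nonroot hv hb hc hbc
    grind

lemma eq_of_isAncestor_child (hH : F.IsClimbing f H) (hf : F.IsMarking f) (hyx : H.Adj y x)
    (hyq : H.Adj y q) (hpq : F.parent q = y) (hqx : F.IsAncestor q x) : x = q := by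
  by_contra hne
  have hchild : ∀ z, G.Adj y z → F.parent z = y → F.depth z = F.depth y + 1 := fun z hz hpz => by
    rw [← hpz, F.depth_parent_add_one z (hpz ▸ hz.ne)]
  have hdq := hchild q (hH.le hyq) hpq
  have hdx := hqx.depth_le
  by_cases hy : F.IsRoot y
  · have hpx : F.parent x ≠ y := fun hpx =>
      hne ((IsAncestor.refl x).eq_of_depth_eq hqx
        ((hchild x (hH.le hyx) hpx).trans hdq.symm))
    refine hH.root hy hyq hyx (Ne.symm hne) ?_
    exact hqx.eq_of_depth_eq (hf.isAncestor y hy x (hH.le hyx) hpx)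
      (hdq.trans (hchild (f y) (hf.adj y) (hf.parent_eq y hy)).symm)
  · have hdy := F.depth_parent_add_one y hy
    rcases hH.nonroot hy hyx hyq hne with rfl | rfl <;> omega

theorem exists_subsingleton_neighborSet [Finite V] (hH : F.IsClimbing f H) (hF : F.IsNormal)
    (hf : F.IsMarking f) (K : H.ConnectedComponent) :
    ∃ u ∈ K.supp, (H.neighborSet u).Subsingleton := by
  by_contra! hK
  obtain ⟨x, hx, hmax⟩ := Set.exists_max_image K.supp F.depth (Set.toFinite _) K.nonempty_supp
  have hancestor : ∀ k, F.parent^[k] x ∈ K.supp := fun k => by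
    induction k with
    | zero => exact hx
    | succ k ih =>
      rw [Function.iterate_succ_apply']
      by_cases hr : F.IsRoot (F.parent^[k] x)
      · rwa [hr]
      · exact (K.mem_supp_congr_adj (hH.adj_parent hr (hK _ ih))).1 ih
  obtain ⟨y, hxy, hyp⟩ := (hK x hx).exists_ne (F.parent x)
  have hd : F.depth y < F.depth x :=
    (hmax y ((K.mem_supp_congr_adj hxy).1 hx)).lt_of_ne (hF.depth_ne (hH.le hxy)).symm
  obtain ⟨q, hyq, hpq, hdq, k, rfl⟩ := (hF (hH.le hxy.symm) hd.le).exists_child hd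
  have hqy := hH.adj_parent (fun hr => hyq.ne (hpq.symm.trans hr)) (hK _ (hancestor k))
  rw [hpq] at hqy
  have hxq := hH.eq_of_isAncestor_child hf hxy.symm hqy.symm hpq ⟨k, rfl⟩
  exact hyp (hxq ▸ hpq.symm)

theorem exists_iso_pathGraph [Finite V] (hH : F.IsClimbing f H) (hF : F.IsNormal)
    (hf : F.IsMarking f) (hG : ∀ v, (G.neighborSet v).ncard ≤ 3) (K : H.ConnectedComponent) :
    ∃ t, Nonempty (K.toSimpleGraph ≃g SimpleGraph.pathGraph (t + 1)) := by
  obtain ⟨u, hu, hsub⟩ := hH.exists_subsingleton_neighborSet hF hf K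
  refine exists_iso_pathGraph_of_connected K.connected_toSimpleGraph (fun v => ?_) (u := ⟨u, hu⟩) ?_
  · exact (Set.ncard_le_ncard_of_injOn Subtype.val (fun _ h => h)
      Subtype.val_injective.injOn).trans (hH.ncard_neighborSet_le_two hf hG v)
  · exact fun a ha b hb => Subtype.ext (hsub ha hb)

end IsClimbing

end RootedForest

namespace RootedForest

variable {V : Type*} {G H : SimpleGraph V} {F : RootedForest G} {f : V → V} {w : ℕ → V}
  {k l m t : ℕ}

/-- The `l` edges that lead upwards from `v` in the forest all belong to `H`. -/
def Climbs (F : RootedForest G) (H : SimpleGraph V) (v : V) (l : ℕ) : Prop :=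
  ∀ i < l, H.Adj (F.parent^[i] v) (F.parent^[i + 1] v)

/-- The vertices `w 0, …, w m` form a walk of `H` that does not turn back and has no root among its
inner vertices. -/
structure IsRootFreeWalk (F : RootedForest G) (H : SimpleGraph V) (w : ℕ → V) (m : ℕ) :
    Prop where
  adj : ∀ i < m, H.Adj (w i) (w (i + 1))
  ne : ∀ i, i + 2 ≤ m → w i ≠ w (i + 2)
  not_isRoot : ∀ i, 0 < i → i < m → ¬ F.IsRoot (w i)

namespace IsRootFreeWalk

lemma shift (hw : F.IsRootFreeWalk H w m) (k : ℕ) :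
    F.IsRootFreeWalk H (fun i => w (k + i)) (m - k) where
  adj i hi := hw.adj (k + i) (by omega)
  ne i hi := hw.ne (k + i) (by omega)
  not_isRoot i h₀ hi := hw.not_isRoot (k + i) (by omega) (by omega)

lemma reverse (hw : F.IsRootFreeWalk H w m) (hk : k ≤ m) :
    F.IsRootFreeWalk H (fun i => w (k - i)) k where
  adj i hi := by
    have h := (hw.adj (k - (i + 1)) (by omega)).symm
    rwa [show k - (i + 1) + 1 = k - i by omega] at h
  ne i hi := by
    have h := (hw.ne (k - (i + 2)) (by omega)).symm
    rwa [show k - (i + 2) + 2 = k - i by omega] at h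
  not_isRoot i h₀ hi := hw.not_isRoot (k - i) (by omega) (by omega)

lemma climbs (hw : F.IsRootFreeWalk H w m) (hH : F.IsClimbing f H)
    (hstart : F.parent (w 0) = w 1) : F.Climbs H (w 0) m := by
  have hparent : ∀ i < m, F.parent (w i) = w (i + 1) := by
    intro i
    induction i with
    | zero => exact fun _ => hstart
    | succ i ih =>
      intro hi
      have hp := ih (by omega)
      have hadj := hw.adj i (by omega)
      have hroot := hw.not_isRoot (i + 1) (by omega) hi
      refine ((hH.nonroot hroot hadj.symm (hw.adj (i + 1) hi)
        (hw.ne i (by omega))).resolve_left fun hback => ?_).symm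
      have hd := F.depth_parent_add_one (w i) (hp ▸ hadj.ne')
      have hd' := F.depth_parent_add_one _ hroot
      rw [hp] at hd
      rw [← hback] at hd'
      omega
  have hiterate : ∀ i ≤ m, F.parent^[i] (w 0) = w i := by
    intro i
    induction i with
    | zero => exact fun _ => rfl
    | succ i ih =>
      intro hi
      rw [Function.iterate_succ_apply', ih (by omega), hparent i (by omega)]
  intro i hi
  rw [hiterate i hi.le, hiterate (i + 1) hi]
  exact hw.adj i hi

lemma lt_two_mul (hw : F.IsRootFreeWalk H w m) (hH : F.IsClimbing f H) (hl : 0 < l)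
    (hclimb : ∀ v, ¬ F.Climbs H v l) : m < 2 * l := by
  by_contra! hm
  obtain ⟨k, rfl⟩ : ∃ k, l = k + 1 := Nat.exists_eq_add_one.2 hl
  rcases hH.nonroot (hw.not_isRoot (k + 1) hl (by omega)) (hw.adj k (by omega)).symm
    (hw.adj (k + 1) (by omega)) (hw.ne k (by omega)) with h | h
  · exact hclimb _ ((hw.reverse (k := k + 1) (by omega)).climbs hH (by simpa using h.symm))
  · have hclimbs := (hw.shift (k + 1)).climbs hH (by simpa using h.symm)
    exact hclimb _ fun i hi => hclimbs i (by omega)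

end IsRootFreeWalk

lemma IsClimbing.lt_four_mul (hH : F.IsClimbing f H) (hF : F.IsNormal) (hl : 0 < l)
    (hclimb : ∀ v, ¬ F.Climbs H v l) (hadj : ∀ i < t, H.Adj (w i) (w (i + 1)))
    (hinj : Set.InjOn w (Set.Iic t)) : t < 4 * l := by
  have hroot : ∀ i ≤ t, F.root (w i) = F.root (w 0) := by
    intro i
    induction i with
    | zero => exact fun _ => rfl
    | succ i ih =>
      intro hi
      rw [← ih (by omega), hF.root_eq_of_adj (hH.le (hadj i hi))]
  have hne : ∀ i, i + 2 ≤ t → w i ≠ w (i + 2) := fun i hi h => by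
    have := hinj (Set.mem_Iic.2 (by omega)) (Set.mem_Iic.2 hi) h
    omega
  -- A path meets at most one root, and each part into which it cuts the path goes up, then down.
  obtain ⟨j, hj, hj_unique⟩ : ∃ j ≤ t, ∀ i ≤ t, F.IsRoot (w i) → i = j := by
    by_cases hex : ∃ j ≤ t, F.IsRoot (w j)
    · obtain ⟨j, hj, hrj⟩ := hex
      refine ⟨j, hj, fun i hi hri => hinj hi hj ?_⟩
      rw [← hri.root_eq, ← hrj.root_eq, hroot i hi, hroot j hj]
    · push Not at hex
      exact ⟨0, t.zero_le, fun i hi hri => absurd hri (hex i hi)⟩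
  have hleft : F.IsRootFreeWalk H w j :=
    ⟨fun i hi => hadj i (by omega), fun i hi => hne i (by omega),
      fun i _ hi hri => hi.ne (hj_unique i (by omega) hri)⟩
  have hright : F.IsRootFreeWalk H (fun i => w (j + i)) (t - j) :=
    ⟨fun i hi => hadj (j + i) (by omega), fun i hi => hne (j + i) (by omega),
      fun i h₀ hi hri => h₀.ne' (by simpa using hj_unique (j + i) (by omega) hri)⟩
  have := hleft.lt_two_mul hH hl hclimb
  have := hright.lt_two_mul hH hl hclimb
  omega

theorem IsClimbing.lt_of_iso_pathGraph (hH : F.IsClimbing f H) (hF : F.IsNormal) (hl : 0 < l)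
    (hclimb : ∀ v, ¬ F.Climbs H v l) {K : H.ConnectedComponent}
    (e : K.toSimpleGraph ≃g SimpleGraph.pathGraph (t + 1)) : t < 4 * l := by
  let w : ℕ → V := fun i => (e.symm (Fin.ofNat (t + 1) i)).1
  have hval : ∀ {i}, i ≤ t → (Fin.ofNat (t + 1) i).1 = i := fun hi =>
    Nat.mod_eq_of_lt (Nat.lt_succ_of_le hi)
  refine hH.lt_four_mul (w := w) hF hl hclimb (fun i hi => ?_) fun i hi j hj hij => ?_
  · refine e.symm.map_adj_iff.2 (SimpleGraph.pathGraph_adj.2 (.inl ?_))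
    rw [hval hi.le, hval hi]
  · rw [← hval hi, ← hval hj, e.symm.injective (Subtype.ext hij)]

end RootedForest

/-! ### Choice of the bits -/

open Classical Finset in
lemma card_filter_exists_mul_le {α ι : Type*} [Fintype α] (s : Finset ι) (P : ι → α → Prop)
    {k N : ℕ} (h : ∀ i ∈ s, #{a | P i a} * (#s * k) ≤ N) : #{a | ∃ i ∈ s, P i a} * k ≤ N := by
  rcases s.eq_empty_or_nonempty with rfl | hs
  · simp
  have hunion : #{a | ∃ i ∈ s, P i a} ≤ ∑ i ∈ s, #{a | P i a} := by
    refine (card_le_card fun a ha => ?_).trans card_biUnion_le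
    simpa using ha
  refine Nat.le_of_mul_le_mul_left ?_ hs.card_pos
  calc #s * (#{a | ∃ i ∈ s, P i a} * k)
      ≤ #s * ((∑ i ∈ s, #{a | P i a}) * k) := by gcongr
    _ = ∑ i ∈ s, #{a | P i a} * (#s * k) := by
      rw [← sum_mul]
      ring
    _ ≤ #s * N := sum_le_card_nsmul s _ N h

namespace RootedForest

open EdgeColour

variable {V : Type*} {G H : SimpleGraph V} {F : RootedForest G} {E : G.EdgeLabeling (Bool × V)}
  {v : V} {l : ℕ}

lemma Climbs.le_depth (h : F.Climbs H v l) : l ≤ F.depth v := by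
  by_contra! hl
  have hadj := h _ hl
  rw [Function.iterate_succ_apply'] at hadj
  exact hadj.ne' (isRoot_root v)

lemma Climbs.injOn (h : F.Climbs H v l) : Set.InjOn (fun i => F.parent^[i] v) (Finset.range l) := by
  intro i hi j hj hij
  have hd := congrArg F.depth hij
  simp only [depth_iterate] at hd
  simp only [Finset.coe_range, Set.mem_Iio] at hi hj
  have := h.le_depth
  omega

variable [Fintype V] {M m T : ℕ}

open Classical Finset in
lemma card_climbs_mul_le (hM : ∀ u, (ownedVertices E u).ncard ≤ M) (hM₀ : 0 < M)
    (F : RootedForest G) (c : EdgeColour) (v : V) :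
    #{b | F.Climbs ((colouring E b).labelGraph c) v (M * m)} * 2 ^ m ≤ 2 ^ Fintype.card V := by
  rcases eq_empty_or_nonempty
    ({b | F.Climbs ((colouring E b).labelGraph c) v (M * m)} : Finset (V → Bool))
    with hempty | ⟨b₀, hb₀⟩
  · simp [hempty]
  have hcard : M * m ≤ #((range (M * m)).image fun i => F.parent^[i] v) := by
    rw [card_image_of_injOn (mem_filter.1 hb₀).2.injOn, card_range]
  refine le_trans (Nat.mul_le_mul_right _ (card_le_card fun b hb => ?_))
    (card_forall_labelGraph_adj_mul_le hM hM₀ hcard F.parent c)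
  rw [mem_filter_univ, forall_mem_image]
  intro i hi
  have hadj := (mem_filter.1 hb).2 i (mem_range.1 hi)
  rwa [Function.iterate_succ_apply'] at hadj

open Classical Finset in
/-- By the union bound the first property fails with probability at most `1 / 4`, and the second
with probability at most `1 / 2`. -/
theorem exists_forall_not_climbs_and_abs_pathDiff_le
    (hM : ∀ u, (ownedVertices E u).ncard ≤ M) (hM₀ : 0 < M) (F : RootedForest G)
    (hm : 8 * Fintype.card V ≤ 2 ^ m) {y : ℝ} (hy : 0 < y) (hyn : y ^ 3 = Fintype.card V)
    (hT : 2 * T * M ^ 2 ≤ y) :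
    ∃ b, (∀ c v, ¬ F.Climbs ((colouring E b).labelGraph c) v (M * m)) ∧
      ∀ t < T, |pathDiff E t b| ≤ y ^ 2 := by
  have hclimb := card_filter_exists_mul_le (k := 4) (N := 2 ^ Fintype.card V)
    (({red, blue} : Finset EdgeColour) ×ˢ (univ : Finset V))
    (fun cv b => F.Climbs ((colouring E b).labelGraph cv.1) cv.2 (M * m)) fun cv _ => by
      refine le_trans (Nat.mul_le_mul_left _ ?_) (card_climbs_mul_le hM hM₀ F cv.1 cv.2)
      rw [card_product, card_pair (by simp), card_univ]
      omega
  have hdiff := card_filter_exists_mul_le (k := 2) (N := 2 ^ Fintype.card V) (range T)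
    (fun t b => y ^ 2 < |pathDiff E t b|) fun t _ => by
      have h := card_lt_abs_pathDiff_mul_le hM t hy hyn
      have hM₀' : (0 : ℝ) < M ^ 2 := by positivity
      rw [card_range]
      suffices h' : (#{b | y ^ 2 < |pathDiff E t b|} * (T * 2) : ℝ) ≤ 2 ^ Fintype.card V by
        exact_mod_cast h'
      refine le_of_mul_le_mul_right ?_ hM₀'
      calc (#{b | y ^ 2 < |pathDiff E t b|} * (T * 2) * M ^ 2 : ℝ)
          = #{b | y ^ 2 < |pathDiff E t b|} * (2 * T * M ^ 2) := by ring
        _ ≤ #{b | y ^ 2 < |pathDiff E t b|} * y := by gcongr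
        _ ≤ 2 ^ Fintype.card V * M ^ 2 := h
  by_contra! hbad
  have hcover : (univ : Finset (V → Bool)) ⊆
      ({b | ∃ cv ∈ ({red, blue} : Finset EdgeColour) ×ˢ (univ : Finset V),
        F.Climbs ((colouring E b).labelGraph cv.1) cv.2 (M * m)} : Finset (V → Bool)) ∪
      ({b | ∃ t ∈ range T, y ^ 2 < |pathDiff E t b|} : Finset (V → Bool)) := fun b _ => by
    simp only [mem_union, mem_filter_univ, mem_product, mem_univ, and_true, mem_range]
    by_contra! h
    obtain ⟨t, ht, hlt⟩ := hbad b fun c v => h.1 (c, v) (by cases c <;> simp)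
    exact hlt.not_ge (h.2 t ht)
  have htotal := (card_le_card hcover).trans (card_union_le _ _)
  have hpos : 0 < 2 ^ Fintype.card V := by positivity
  rw [card_univ, Fintype.card_fun, Fintype.card_bool] at htotal
  omega

end RootedForest

lemma eight_mul_le_two_pow_natLog_add_four (n : ℕ) : 8 * n ≤ 2 ^ (Nat.log 2 n + 4) := by
  have h := Nat.lt_pow_succ_log_self one_lt_two n
  calc 8 * n ≤ 8 * 2 ^ (Nat.log 2 n + 1) := by gcongr
    _ = 2 ^ (Nat.log 2 n + 4) := by ring

lemma natLog_two_add_four_le {n : ℕ} (hn : 3 ≤ n) : (Nat.log 2 n + 4 : ℝ) ≤ 6 * Real.log n := by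
  have hn' : (3 : ℝ) ≤ n := by exact_mod_cast hn
  have hone : 1 ≤ Real.log n := by
    rw [Real.le_log_iff_exp_le (by linarith)]
    linarith [Real.exp_one_lt_d9]
  have hlogb : Real.logb 2 n ≤ 2 * Real.log n := by
    rw [Real.logb, div_le_iff₀ (Real.log_pos one_lt_two)]
    nlinarith [Real.log_two_gt_d9]
  have hnat : (Nat.log 2 n : ℝ) ≤ Real.logb 2 n := Real.natLog_le_logb n 2
  linarith

lemma eventually_mul_log_le_rpow (a : ℝ) {r : ℝ} (hr : 0 < r) :
    ∀ᶠ n : ℕ in Filter.atTop, a * Real.log n ≤ (n : ℝ) ^ r := by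
  have h := ((isLittleO_log_rpow_atTop hr).const_mul_left a).bound one_pos
  filter_upwards [tendsto_natCast_atTop_atTop.eventually h] with n hn
  rw [one_mul, Real.norm_of_nonneg (by positivity : (0 : ℝ) ≤ (n : ℝ) ^ r)] at hn
  exact (Real.le_norm_self _).trans hn

open RootedForest EdgeColour in
theorem exists_labeling_isPathOfLength_and_abs_sub_le {V : Type*} [Fintype V]
    {G : SimpleGraph V} (hG : ∀ v, (G.neighborSet v).ncard = 3) {m : ℕ} {y : ℝ}
    (hm : 8 * Fintype.card V ≤ 2 ^ m) (hy : 0 < y) (hyn : y ^ 3 = Fintype.card V)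
    (hmy : 2 ^ 21 * m ≤ y) :
    ∃ χ : G.EdgeLabeling EdgeColour,
      (∀ (c : EdgeColour) (K : MonoComponent χ c), ∃ t < 256 * m, IsPathOfLength K t) ∧
      ∀ t, |(numPaths χ red t : ℝ) - numPaths χ blue t| ≤ y ^ 2 := by
  obtain ⟨F, hF⟩ := exists_isNormal G
  obtain ⟨f, hf⟩ := hF.exists_isMarking hG
  have hE := hF.isAdapted_labeling hf hG
  have hM : ∀ u, (ownedVertices (hF.labeling f) u).ncard ≤ 64 :=
    ncard_ownedVertices_le (k := 3) (fun v => (hG v).le) fun _ _ => hF.edist_get_labeling_le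
  obtain ⟨b, hclimb, hdiff⟩ := exists_forall_not_climbs_and_abs_pathDiff_le (T := 256 * m) hM
    (by norm_num) F hm hy hyn (by push_cast; linarith)
  have hm₀ : 0 < m := by
    have hV : (0 : ℝ) < Fintype.card V := hyn ▸ pow_pos hy 3
    refine Nat.pos_of_ne_zero fun h => ?_
    rw [h, pow_zero] at hm
    have : 0 < Fintype.card V := by exact_mod_cast hV
    omega
  have hlt : ∀ c (K : MonoComponent (colouring (hF.labeling f) b) c) t,
      IsPathOfLength K t → t < 256 * m := fun c K t ⟨e⟩ => by
    have := (hE.isClimbing b c).lt_of_iso_pathGraph hF (by omega) (hclimb c) e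
    omega
  refine ⟨colouring (hF.labeling f) b, fun c K => ?_, fun t => ?_⟩
  · obtain ⟨t, ht⟩ := (hE.isClimbing b c).exists_iso_pathGraph hF hf (fun v => (hG v).le) K
    exact ⟨t, hlt c K t ht, ht⟩
  · by_cases ht : t < 256 * m
    · exact hdiff t ht
    · have hzero : ∀ c, numPaths (colouring (hF.labeling f) b) c t = 0 := fun c =>
        (Set.ncard_eq_zero (Set.toFinite _)).2 <|
          Set.eq_empty_of_forall_notMem fun K hK => ht (hlt c K t hK)
      simpa [hzero] using sq_nonneg y

theorem theorem1p5 :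
    ∃ (C : ℝ) (N : ℕ), ∀ (V : Type*) [Fintype V] (G : SimpleGraph V) [DecidableRel G.Adj],
      G.IsRegularOfDegree 3 → N ≤ Fintype.card V →
      ∃ χ : G.EdgeLabeling EdgeColour,
        (∀ (c : EdgeColour) (K : EdgeColour.MonoComponent χ c),
          ∃ t : ℕ, EdgeColour.IsPathOfLength K t ∧
            (t : ℝ) ≤ C * Real.log (Fintype.card V)) ∧
        ∀ t : ℕ, 1 ≤ t →
          |(EdgeColour.numPaths χ EdgeColour.red t : ℝ) -
              (EdgeColour.numPaths χ EdgeColour.blue t : ℝ)| ≤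
            (Fintype.card V : ℝ) ^ ((2 : ℝ) / 3) := by
  obtain ⟨N, hN⟩ := Filter.eventually_atTop.1
    (eventually_mul_log_le_rpow (2 ^ 21 * 6) (r := 1 / 3) (by norm_num))
  refine ⟨256 * 6, max N 3, fun V _ G _ hG hcard => ?_⟩
  obtain ⟨hNcard, hcard₃⟩ := max_le_iff.1 hcard
  have hncard : ∀ v, (G.neighborSet v).ncard = 3 := fun v => by
    rw [Set.ncard_eq_toFinset_card', ← SimpleGraph.neighborFinset, G.card_neighborFinset_eq_degree,
      hG v]
  have hm := natLog_two_add_four_le hcard₃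
  have hpow : ∀ k : ℕ, ((Fintype.card V : ℝ) ^ ((1 : ℝ) / 3)) ^ k =
      (Fintype.card V : ℝ) ^ ((k : ℝ) / 3) := fun k => by
    rw [← Real.rpow_mul_natCast (Nat.cast_nonneg _), one_div_mul_eq_div]
  obtain ⟨χ, hpath, hdiff⟩ := exists_labeling_isPathOfLength_and_abs_sub_le hncard
    (eight_mul_le_two_pow_natLog_add_four _)
    (y := (Fintype.card V : ℝ) ^ ((1 : ℝ) / 3)) (by positivity)
    (by rw [hpow]; norm_num) (by push_cast; linarith [hN _ hNcard])
  refine ⟨χ, fun c K => ?_, fun t _ => (hdiff t).trans_eq (hpow 2)⟩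
  obtain ⟨t, ht, hK⟩ := hpath c K
  have ht' : (t : ℝ) ≤ 256 * (Nat.log 2 (Fintype.card V) + 4) := by exact_mod_cast ht.le
  exact ⟨t, hK, by linarith⟩
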